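/- Let $U\subseteq\mathbb{R}^4$ be a connected open set, let $\lambda:U\to(0,\infty)$ be smooth, and let $\tilde g=\lambda^2\,dx^2$, where $dx^2$ is the Euclidean metric. The metric $\tilde g$ is called biharmonic if the identity map $\phi=\mathrm{id}:(U,dx^2)\to(U,\tilde g)$ is a biharmonic map, i.e. satisfies the Euler–Lagrange equation of the bienergy $\int|\tau(\phi)|^2$, $$\tau_2(\phi)=-\mathrm{Tr}_g(\nabla^{\phi})^2\tau(\phi)-\mathrm{Tr}_g R^{\tilde g}(\tau(\phi),d\phi)d\phi=0,\qquad \tau(\phi)=\mathrm{Tr}_g\nabla d\phi ,\quad g=dx^2,$$ where $R^{\tilde g}(X,Y)Z=\tilde\nabla_X\tilde\nabla_YZ-\tilde\nabla_Y\tilde\nabla_XZ-\tilde\nabla_{[X,Y]}Z$ is the curvature of $\tilde g$. Then $\tilde g$ is biharmonic if and only if there is a constant $R\in\mathbb{R}$ such that $\lambda$ solves the Yamabe equation on $(U,g)$, $$-\frac{4(n-1)}{n-2}\,\Delta_g\lambda+R_g\lambda=R\,\lambda^{(n+2)/(n-2)},\qquad n=4,\ g=dx^2,$$ where $R_g$ is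 the scalar curvature of $g$ and $\Delta_g=\mathrm{div}\,\mathrm{grad}$. Moreover, for every $R\in\mathbb{R}$, $\lambda$ solves this equation with the constant $R$ if and only if the Riemannian manifold $(U,\lambda^2dx^2)$ has constant scalar curvature $R$ and $\Delta\lambda=-\frac{R}{6}\lambda^3$ on $U$, where $\Delta$ is the Euclidean Laplacian. -/

import Mathlib

open Set
open scoped ContDiff

noncomputable section

namespace BiharmonicMetric

/-- The points of `ℝⁿ`. -/
abbrev E (n : ℕ) : Type := EuclideanSpace ℝ (Fin n)

/-- A field of `n × n` matrices on `ℝⁿ`: the matrix `(g_{ij})` of a metric in the standard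
coordinates. Metrics on an open set `U` are fields whose values off `U` are irrelevant. -/
abbrev MetricField (n : ℕ) : Type := E n → Matrix (Fin n) (Fin n) ℝ

/-- The partial derivative `∂ᵢ f`. -/
def pd {n : ℕ} (i : Fin n) (f : E n → ℝ) (x : E n) : ℝ :=
  fderiv ℝ f x (EuclideanSpace.single i 1)

/-- The Euclidean metric `dx²`. -/
def euclideanMetric (n : ℕ) : MetricField n := fun _ => 1

/-- The conformally flat metric `l² dx²`. -/
def conformalMetric {n : ℕ} (l : E n → ℝ) : MetricField n := fun x => (l x) ^ 2 • 1

/-- The Christoffel symbol `Γᵏᵢⱼ` of the Levi-Civita connection of `g`. -/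
def christoffel {n : ℕ} (g : MetricField n) (k i j : Fin n) (x : E n) : ℝ :=
  (1 / 2) * ∑ l, (g x)⁻¹ k l *
    (pd i (fun y => g y j l) x + pd j (fun y => g y i l) x - pd l (fun y => g y i j) x)

/-- The component `Rˡₖᵢⱼ` of the curvature tensor: `R(∂ᵢ, ∂ⱼ) ∂ₖ = ∑ₗ Rˡₖᵢⱼ ∂ₗ`, where
`R(X, Y) Z = ∇_X ∇_Y Z - ∇_Y ∇_X Z - ∇_[X, Y] Z`. -/
def riemann {n : ℕ} (g : MetricField n) (l k i j : Fin n) (x : E n) : ℝ :=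
  pd i (christoffel g l j k) x - pd j (christoffel g l i k) x
    + ∑ m, (christoffel g l i m x * christoffel g m j k x
        - christoffel g l j m x * christoffel g m i k x)

/-- The Ricci tensor: `Ric(Y, Z)` is the trace of `X ↦ R(X, Y) Z`. -/
def ricci {n : ℕ} (g : MetricField n) (j k : Fin n) (x : E n) : ℝ :=
  ∑ i, riemann g i k i j x

/-- The scalar curvature. -/
def scalarCurvature {n : ℕ} (g : MetricField n) (x : E n) : ℝ :=
  ∑ j, ∑ k, (g x)⁻¹ j k * ricci g j k x

/-- The Laplace-Beltrami operator `Δ_g f = div grad f = Tr_g ∇ df`. -/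
def laplaceBeltrami {n : ℕ} (g : MetricField n) (f : E n → ℝ) (x : E n) : ℝ :=
  ∑ i, ∑ j, (g x)⁻¹ i j * (pd i (pd j f) x - ∑ k, christoffel g k i j x * pd k f x)

/-- The covariant derivative `∇^φ_{∂ᵢ} V` of a vector field `V = ∑ₐ Vᵃ ∂ₐ` along the map `φ`,
for the pull-back by `φ` of the Levi-Civita connection of the target metric `h`. -/
def covDeriv {m n : ℕ} (h : MetricField n) (φ : E m → E n) (i : Fin m)
    (V : Fin n → E m → ℝ) (a : Fin n) (x : E m) : ℝ :=
  pd i (V a) x + ∑ b, ∑ c, christoffel h a b c (φ x) * pd i (fun y => φ y b) x * V c x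

/-- The tension field `τ(φ) = Tr_g ∇dφ` of `φ : (U, g) → (V, h)`; here
`(∇dφ)(∂ᵢ, ∂ⱼ) = ∇^φ_{∂ᵢ} (dφ ∂ⱼ) - dφ (∇_{∂ᵢ} ∂ⱼ)`. -/
def tension {m n : ℕ} (g : MetricField m) (h : MetricField n) (φ : E m → E n)
    (a : Fin n) (x : E m) : ℝ :=
  ∑ i, ∑ j, (g x)⁻¹ i j *
    (covDeriv h φ i (fun b => pd j (fun y => φ y b)) a x
      - ∑ k, christoffel g k i j x * pd k (fun y => φ y a) x)

/-- The trace `Tr_g (∇^φ)² V` of the second covariant derivative of a vector field along `φ`. -/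
def roughLaplacian {m n : ℕ} (g : MetricField m) (h : MetricField n) (φ : E m → E n)
    (V : Fin n → E m → ℝ) (a : Fin n) (x : E m) : ℝ :=
  ∑ i, ∑ j, (g x)⁻¹ i j *
    (covDeriv h φ i (covDeriv h φ j V) a x
      - ∑ k, christoffel g k i j x * covDeriv h φ k V a x)

/-- The trace `Tr_g R^h(V, dφ) dφ`. -/
def curvatureTrace {m n : ℕ} (g : MetricField m) (h : MetricField n) (φ : E m → E n)
    (V : Fin n → E m → ℝ) (a : Fin n) (x : E m) : ℝ :=
  ∑ i, ∑ j, (g x)⁻¹ i j * ∑ b, ∑ c, ∑ d,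
    riemann h a d b c (φ x) * V b x * pd i (fun y => φ y c) x * pd j (fun y => φ y d) x

/-- The bitension field `τ₂(φ) = -Tr_g (∇^φ)² τ(φ) - Tr_g R^h(τ(φ), dφ) dφ`. -/
def bitension {m n : ℕ} (g : MetricField m) (h : MetricField n) (φ : E m → E n)
    (a : Fin n) (x : E m) : ℝ :=
  - roughLaplacian g h φ (tension g h φ) a x - curvatureTrace g h φ (tension g h φ) a x

/-- `φ : (U, g) → (V, h)` is a biharmonic map: it is smooth and satisfies the Euler-Lagrange
equation `τ₂(φ) = 0` of the bienergy `∫ |τ(φ)|² dv_g`. -/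
def IsBiharmonicMap {m n : ℕ} (U : Set (E m)) (g : MetricField m) (V : Set (E n))
    (h : MetricField n) (φ : E m → E n) : Prop :=
  MapsTo φ U V ∧ ContDiffOn ℝ ∞ φ U ∧ ∀ x ∈ U, ∀ a, bitension g h φ a x = 0

/-- The metric `h` on `U` is biharmonic with respect to `g`: the identity map
`(U, g) → (U, h)` is biharmonic. -/
def IsBiharmonicMetric {n : ℕ} (U : Set (E n)) (g h : MetricField n) : Prop :=
  IsBiharmonicMap U g U h id

/-- The function `u` solves on `U`, with the constant `R`, the Yamabe equation
`-(4(n-1)/(n-2)) Δ_g u + R_g u = R u^((n+2)/(n-2))` of the metric `g` (for `n ≥ 3`, `u > 0`). -/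
def SolvesYamabe {n : ℕ} (U : Set (E n)) (g : MetricField n) (R : ℝ) (u : E n → ℝ) : Prop :=
  ∀ x ∈ U, -(4 * ((n : ℝ) - 1) / ((n : ℝ) - 2)) * laplaceBeltrami g u x
    + scalarCurvature g x * u x = R * (u x) ^ (((n : ℝ) + 2) / ((n : ℝ) - 2))

end BiharmonicMetric

end

/-! Put σ = log λ, with subscripts for Euclidean partial derivatives. The Christoffel symbols of λ²
dx² are linear in dσ, so every tensor in question is an explicit polynomial in the derivatives of σ.
The identity has tension (2 - n)∇σ, and `bitension_id_conformalMetric` gives its bitension as (n -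
2)(∂ₐΔσ + (6 - n) ∑ σ_c σ_ac - ((n - 2)|∇σ|² + 2Δσ) σₐ). The scalar curvature S satisfies λ² S = -(n
- 1)(2Δσ + (n - 2)|∇σ|²), so λ² ∂ₐS is -2(n - 1) times the same bracket, but with n - 2 in place of
6 - n. These agree exactly when n = 4, where τ₂ = -(λ²/3) dS in components
(`bitension_eq_pd_scalarCurvature`). On a connected set, biharmonicity therefore means that S is
constant.

Since Δλ = λ(Δσ + |∇σ|²), dimension four also gives S = -6 Δλ / λ³. Thus S = R is pointwise the
equation Δλ = -(R/6)λ³, which is the Yamabe equation of the flat metric. -/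

noncomputable section

namespace BiharmonicMetric

/-! ### Calculus of partial derivatives on an open set -/

section PartialDerivatives

variable {n : ℕ} {U : Set (E n)} {f g : E n → ℝ} {x : E n}

/-- Nothing is known about λ off U, so the formulas below hold only on U; openness is what allows
them to be differentiated. -/
theorem pd_congr (hU : IsOpen U) (h : EqOn f g U) (hx : x ∈ U) (i : Fin n) :
    pd i f x = pd i g x := by
  unfold pd
  rw [(h.eventuallyEq_of_mem (hU.mem_nhds hx)).fderiv_eq]

@[simp] theorem pd_const (i : Fin n) (c : ℝ) (x : E n) : pd i (fun _ => c) x = 0 := by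
  simp [pd]

theorem pd_add (hf : DifferentiableAt ℝ f x) (hg : DifferentiableAt ℝ g x) (i : Fin n) :
    pd i (fun y => f y + g y) x = pd i f x + pd i g x := by
  simp [pd, fderiv_fun_add hf hg]

theorem pd_sub (hf : DifferentiableAt ℝ f x) (hg : DifferentiableAt ℝ g x) (i : Fin n) :
    pd i (fun y => f y - g y) x = pd i f x - pd i g x := by
  simp [pd, fderiv_fun_sub hf hg]

theorem pd_mul (hf : DifferentiableAt ℝ f x) (hg : DifferentiableAt ℝ g x) (i : Fin n) :
    pd i (fun y => f y * g y) x = f x * pd i g x + g x * pd i f x := by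
  simp [pd, fderiv_fun_mul hf hg]

theorem pd_const_mul (hf : DifferentiableAt ℝ f x) (c : ℝ) (i : Fin n) :
    pd i (fun y => c * f y) x = c * pd i f x := by
  simp [pd, fderiv_const_mul hf]

theorem pd_sum {ι : Type*} {s : Finset ι} {F : ι → E n → ℝ}
    (hF : ∀ j ∈ s, DifferentiableAt ℝ (F j) x) (i : Fin n) :
    pd i (fun y => ∑ j ∈ s, F j y) x = ∑ j ∈ s, pd i (F j) x := by
  simp [pd, fderiv_fun_sum hF]

theorem pd_ite (c : Prop) [Decidable c] (i : Fin n) :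
    pd i (fun y => if c then f y else 0) x = if c then pd i f x else 0 := by
  split_ifs <;> simp

theorem pd_coord (i a : Fin n) (x : E n) : pd i (fun y => y a) x = if a = i then 1 else 0 := by
  have h : (fun y : E n => y a) = (EuclideanSpace.proj a : E n →L[ℝ] ℝ) := rfl
  rw [pd, h, ContinuousLinearMap.fderiv]
  simp

theorem pd_log (hf : DifferentiableAt ℝ f x) (h0 : f x ≠ 0) (i : Fin n) :
    pd i (fun y => Real.log (f y)) x = pd i f x / f x := by
  simp [pd, (hf.hasFDerivAt.log h0).fderiv, div_eq_inv_mul]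

theorem contDiffOn_pd (hU : IsOpen U) (hf : ContDiffOn ℝ ∞ f U) (i : Fin n) :
    ContDiffOn ℝ ∞ (pd i f) U :=
  (hf.fderiv_of_isOpen hU (by simp)).clm_apply contDiffOn_const

theorem differentiableAt_of_contDiffOn (hU : IsOpen U) (hf : ContDiffOn ℝ ∞ f U) (hx : x ∈ U) :
    DifferentiableAt ℝ f x :=
  (hf.contDiffAt (hU.mem_nhds hx)).differentiableAt (by simp)

theorem pd_pd_eq (hU : IsOpen U) (hf : ContDiffOn ℝ ∞ f U) (hx : x ∈ U) (i j : Fin n) :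
    pd i (pd j f) x = fderiv ℝ (fderiv ℝ f) x (EuclideanSpace.single i 1)
      (EuclideanSpace.single j 1) := by
  have h : DifferentiableAt ℝ (fderiv ℝ f) x :=
    ((hf.fderiv_of_isOpen (m := ∞) hU (by simp)).contDiffAt (hU.mem_nhds hx)).differentiableAt
      (by simp)
  have h2 : pd j f = fun y => fderiv ℝ f y (EuclideanSpace.single j 1) := rfl
  rw [pd, h2, fderiv_clm_apply h (differentiableAt_const _)]
  simp

theorem pd_comm (hU : IsOpen U) (hf : ContDiffOn ℝ ∞ f U) (hx : x ∈ U) (i j : Fin n) :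
    pd i (pd j f) x = pd j (pd i f) x := by
  rw [pd_pd_eq hU hf hx, pd_pd_eq hU hf hx]
  refine (hf.contDiffAt (hU.mem_nhds hx)).isSymmSndFDerivAt ?_ _ _
  simpa using WithTop.coe_le_coe.2 (le_top (a := (2 : ℕ∞)))

theorem laplacian_eq_sum_pd (hU : IsOpen U) (hf : ContDiffOn ℝ ∞ f U) (hx : x ∈ U) :
    Laplacian.laplacian f x = ∑ i, pd i (pd i f) x := by
  rw [InnerProductSpace.laplacian_eq_iteratedFDeriv_orthonormalBasis f
    (EuclideanSpace.basisFun (Fin n) ℝ)]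
  refine Finset.sum_congr rfl fun i _ => ?_
  rw [pd_pd_eq hU hf hx, iteratedFDeriv_two_apply]
  simp

/-- A smooth function with vanishing partial derivatives on a connected open set is constant. -/
theorem exists_eq_const_of_pd_eq_zero (hU : IsOpen U) (hUc : IsPreconnected U)
    (hf : ContDiffOn ℝ ∞ f U) (h : ∀ x ∈ U, ∀ i, pd i f x = 0) : ∃ c, ∀ x ∈ U, f x = c := by
  refine hU.exists_is_const_of_fderiv_eq_zero hUc (hf.differentiableOn (by simp)) fun x hx => ?_
  have : (fderiv ℝ f x : E n →ₗ[ℝ] ℝ) = 0 :=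
    (EuclideanSpace.basisFun (Fin n) ℝ).toBasis.ext fun i => by simpa [pd] using h x hx i
  ext v
  exact congrArg (fun L : E n →ₗ[ℝ] ℝ => L v) this

end PartialDerivatives

/-! ### The flat metric -/

section Euclidean

variable {n : ℕ}

@[simp] theorem euclideanMetric_inv (x : E n) : (euclideanMetric n x)⁻¹ = 1 := by
  simp [euclideanMetric]

@[simp] theorem christoffel_euclideanMetric (k i j : Fin n) (x : E n) :
    christoffel (euclideanMetric n) k i j x = 0 := by
  simp [christoffel, euclideanMetric]

@[simp] theorem scalarCurvature_euclideanMetric (x : E n) :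
    scalarCurvature (euclideanMetric n) x = 0 := by
  have h (k i j : Fin n) : christoffel (euclideanMetric n) k i j = fun _ => 0 :=
    funext fun x => christoffel_euclideanMetric k i j x
  simp [scalarCurvature, ricci, riemann, h]

theorem laplaceBeltrami_euclideanMetric (f : E n → ℝ) (x : E n) :
    laplaceBeltrami (euclideanMetric n) f x = ∑ i, pd i (pd i f) x := by
  simp [laplaceBeltrami, Matrix.one_apply]

end Euclidean

/-! ### Curvature of a conformally flat metric -/

section Conformal

variable {n : ℕ} {U : Set (E n)} {l : E n → ℝ} {x : E n}

/-- The logarithmic conformal factor `log l` of the metric `l² dx²`. -/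
def logFactor (l : E n → ℝ) (x : E n) : ℝ := Real.log (l x)

theorem contDiffOn_logFactor (hl : ContDiffOn ℝ ∞ l U) (hpos : ∀ x ∈ U, 0 < l x) :
    ContDiffOn ℝ ∞ (logFactor l) U :=
  hl.log fun x hx => (hpos x hx).ne'

theorem conformalMetric_inv (h0 : l x ≠ 0) :
    (conformalMetric l x)⁻¹ = ((l x) ^ 2)⁻¹ • (1 : Matrix (Fin n) (Fin n) ℝ) := by
  refine Matrix.inv_eq_left_inv ?_
  rw [conformalMetric, smul_mul_smul_comm, inv_mul_cancel₀ (pow_ne_zero 2 h0)]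
  simp

theorem pd_conformalMetric (hf : DifferentiableAt ℝ l x) (i j k : Fin n) :
    pd k (fun y => conformalMetric l y i j) x = if i = j then 2 * l x * pd k l x else 0 := by
  have : (fun y => conformalMetric l y i j) = fun y => if i = j then l y * l y else 0 := by
    funext y
    simp [conformalMetric, Matrix.one_apply, sq]
  rw [this, pd_ite, pd_mul hf hf]
  congr 1; ring

theorem christoffel_conformalMetric (hf : DifferentiableAt ℝ l x) (h0 : l x ≠ 0)
    (k i j : Fin n) :
    christoffel (conformalMetric l) k i j x =
      (if k = i then pd j (logFactor l) x else 0) + (if k = j then pd i (logFactor l) x else 0)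
        - (if i = j then pd k (logFactor l) x else 0) := by
  have hlog (i) : pd i (logFactor l) x = pd i l x / l x := pd_log hf h0 i
  simp only [christoffel, conformalMetric_inv h0, pd_conformalMetric hf, Matrix.smul_apply,
    Matrix.one_apply, hlog, smul_eq_mul, mul_ite, mul_one, mul_zero, ite_mul, zero_mul,
    Finset.sum_ite_eq, Finset.mem_univ, if_true, @eq_comm _ _ k]
  split_ifs <;> field_simp <;> ring

theorem pd_christoffel_conformalMetric (hU : IsOpen U) (hl : ContDiffOn ℝ ∞ l U)
    (hpos : ∀ x ∈ U, 0 < l x) (hx : x ∈ U) (m k i j : Fin n) :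
    pd m (christoffel (conformalMetric l) k i j) x =
      (if k = i then pd m (pd j (logFactor l)) x else 0)
        + (if k = j then pd m (pd i (logFactor l)) x else 0)
        - (if i = j then pd m (pd k (logFactor l)) x else 0) := by
  rw [pd_congr hU (fun y hy => christoffel_conformalMetric
    (differentiableAt_of_contDiffOn hU hl hy) (hpos y hy).ne' k i j) hx]
  have hd (c : Prop) [Decidable c] (i : Fin n) :
      DifferentiableAt ℝ (fun y => if c then pd i (logFactor l) y else 0) x := by
    split_ifs
    · exact differentiableAt_of_contDiffOn hU
        (contDiffOn_pd hU (contDiffOn_logFactor hl hpos) i) hx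
    · exact differentiableAt_const _
  rw [pd_sub ((hd _ _).fun_add (hd _ _)) (hd _ _), pd_add (hd _ _) (hd _ _), pd_ite, pd_ite, pd_ite]

/-- The quadratic expression in the Christoffel symbols of a conformally flat metric. -/
theorem sum_conformal_mul_conformal (s : Fin n → ℝ) (a i j k : Fin n) :
    ∑ m, ((if a = i then s m else 0) + (if a = m then s i else 0) - (if i = m then s a else 0)) *
      ((if m = j then s k else 0) + (if m = k then s j else 0) - (if j = k then s m else 0)) =
    (if a = i then 2 * (s j * s k) - (if j = k then ∑ m, s m ^ 2 else 0) else 0)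
      + s i * ((if a = j then s k else 0) + (if a = k then s j else 0) - (if j = k then s a else 0))
      - s a * ((if i = j then s k else 0) + (if i = k then s j else 0)
        - (if j = k then s i else 0)) := by
  simp only [sub_mul, add_mul, ite_mul, zero_mul, Finset.sum_add_distrib, Finset.sum_sub_distrib,
    Finset.sum_ite_eq, Finset.mem_univ, if_true]
  congr 2
  by_cases h : a = i <;> by_cases h' : j = k <;>
    simp [h, h', mul_add, mul_sub, Finset.sum_add_distrib, Finset.sum_sub_distrib, sq] <;> ring

/-- The curvature is a Kulkarni–Nomizu type combination of δ with Hess σ - dσ ⊗ dσ and |∇σ|² δ: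
derivatives of the Christoffel symbols give the Hessian, their products the rest. -/
theorem riemann_conformalMetric (hU : IsOpen U) (hl : ContDiffOn ℝ ∞ l U)
    (hpos : ∀ x ∈ U, 0 < l x) (hx : x ∈ U) (a k i j : Fin n) :
    riemann (conformalMetric l) a k i j x =
      (if a = j then pd i (pd k (logFactor l)) x - pd i (logFactor l) x * pd k (logFactor l) x
        else 0)
      - (if a = i then pd j (pd k (logFactor l)) x - pd j (logFactor l) x * pd k (logFactor l) x
        else 0)
      + (if i = k then pd a (pd j (logFactor l)) x - pd a (logFactor l) x * pd j (logFactor l) x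
        else 0)
      - (if j = k then pd a (pd i (logFactor l)) x - pd a (logFactor l) x * pd i (logFactor l) x
        else 0)
      + (∑ b, pd b (logFactor l) x ^ 2) *
        ((if a = j then if i = k then 1 else 0 else 0)
          - if a = i then if j = k then 1 else 0 else 0) := by
  have hs := pd_comm hU (contDiffOn_logFactor hl hpos) hx
  simp only [riemann, pd_christoffel_conformalMetric hU hl hpos hx,
    christoffel_conformalMetric (differentiableAt_of_contDiffOn hU hl hx) (hpos x hx).ne']
  simp only [Finset.sum_sub_distrib, sum_conformal_mul_conformal (fun b => pd b (logFactor l) x)]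
  rw [hs i j, hs a i, hs a j]
  simp only [eq_comm (a := j) (b := i)]
  split_ifs <;> ring

theorem ricci_conformalMetric (hU : IsOpen U) (hl : ContDiffOn ℝ ∞ l U)
    (hpos : ∀ x ∈ U, 0 < l x) (hx : x ∈ U) (j k : Fin n) :
    ricci (conformalMetric l) j k x =
      (2 - n) * (pd j (pd k (logFactor l)) x - pd j (logFactor l) x * pd k (logFactor l) x)
      - if j = k then ∑ i, pd i (pd i (logFactor l)) x
        + (n - 2) * ∑ i, pd i (logFactor l) x ^ 2 else 0 := by
  simp only [ricci, riemann_conformalMetric hU hl hpos hx, Finset.sum_add_distrib,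
    Finset.sum_sub_distrib, Finset.sum_ite_eq', Finset.mem_univ, if_true, ← Finset.mul_sum,
    Finset.sum_const, Finset.card_univ, Fintype.card_fin, nsmul_eq_mul]
  rw [pd_comm hU (contDiffOn_logFactor hl hpos) hx k j]
  split_ifs with h
  · subst h
    simp [Finset.sum_sub_distrib, sq]
    ring
  · simp
    ring

theorem scalarCurvature_conformalMetric (hU : IsOpen U) (hl : ContDiffOn ℝ ∞ l U)
    (hpos : ∀ x ∈ U, 0 < l x) (hx : x ∈ U) :
    scalarCurvature (conformalMetric l) x =
      -((n - 1) * (2 * ∑ i, pd i (pd i (logFactor l)) x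
        + (n - 2) * ∑ i, pd i (logFactor l) x ^ 2) / l x ^ 2) := by
  simp only [scalarCurvature, conformalMetric_inv (hpos x hx).ne', Matrix.smul_apply,
    Matrix.one_apply, ricci_conformalMetric hU hl hpos hx, smul_eq_mul, mul_ite, ite_mul, mul_one,
    mul_zero, zero_mul, Finset.sum_ite_eq, Finset.mem_univ, if_true, ← Finset.mul_sum,
    Finset.sum_sub_distrib, Finset.sum_const, Finset.card_univ, Fintype.card_fin, nsmul_eq_mul,
    ← sq]
  field_simp
  ring

theorem laplacian_eq_logFactor (hU : IsOpen U) (hl : ContDiffOn ℝ ∞ l U)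
    (hpos : ∀ x ∈ U, 0 < l x) (hx : x ∈ U) :
    ∑ i, pd i (pd i l) x =
      l x * (∑ i, pd i (pd i (logFactor l)) x + ∑ i, pd i (logFactor l) x ^ 2) := by
  have hd {y} (hy : y ∈ U) := differentiableAt_of_contDiffOn hU hl hy
  have h1 (i : Fin n) : EqOn (pd i l) (fun y => l y * pd i (logFactor l) y) U := fun y hy => by
    have : pd i (logFactor l) y = pd i l y / l y := pd_log (hd hy) (hpos y hy).ne' i
    simp only [this]
    field_simp [(hpos y hy).ne']
  rw [← Finset.sum_add_distrib, Finset.mul_sum]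
  refine Finset.sum_congr rfl fun i _ => ?_
  rw [pd_congr hU (h1 i) hx, pd_mul (hd hx) (differentiableAt_of_contDiffOn hU
    (contDiffOn_pd hU (contDiffOn_logFactor hl hpos) i) hx), h1 i hx]
  ring

/-! ### Tension and bitension of the identity map -/

theorem covDeriv_id_conformalMetric (hf : DifferentiableAt ℝ l x) (h0 : l x ≠ 0) (i : Fin n)
    (V : Fin n → E n → ℝ) (a : Fin n) :
    covDeriv (conformalMetric l) id i V a x =
      pd i (V a) x + (if a = i then ∑ c, pd c (logFactor l) x * V c x else 0)
        + pd i (logFactor l) x * V a x - pd a (logFactor l) x * V i x := by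
  simp only [covDeriv, id, pd_coord, christoffel_conformalMetric hf h0, mul_ite, ite_mul, mul_one,
    mul_zero, zero_mul, add_mul, sub_mul, Finset.sum_add_distrib, Finset.sum_sub_distrib,
    Finset.sum_ite_eq, Finset.sum_ite_eq', Finset.sum_ite_irrel, Finset.sum_const_zero,
    Finset.mem_univ, if_true]
  ring

theorem tension_id_conformalMetric (hf : DifferentiableAt ℝ l x) (h0 : l x ≠ 0) (a : Fin n) :
    tension (euclideanMetric n) (conformalMetric l) id a x =
      (2 - n) * pd a (logFactor l) x := by
  have h (j b : Fin n) : pd j (fun y : E n => y b) = fun _ => if b = j then 1 else 0 :=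
    funext fun y => pd_coord j b y
  simp only [tension, euclideanMetric_inv, Matrix.one_apply, christoffel_euclideanMetric, id,
    covDeriv_id_conformalMetric hf h0, h]
  simp [Finset.sum_add_distrib, Finset.sum_sub_distrib]
  ring

/-- For V proportional to ∇σ the two connection terms σᵢVₐ and σₐVᵢ cancel, leaving only a multiple
of the identity besides the Hessian. -/
theorem covDeriv_id_tension (hU : IsOpen U) (hl : ContDiffOn ℝ ∞ l U)
    (hpos : ∀ x ∈ U, 0 < l x) (hx : x ∈ U) (i a : Fin n) :
    covDeriv (conformalMetric l) id i (tension (euclideanMetric n) (conformalMetric l) id) a x =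
      (2 - n) * (pd i (pd a (logFactor l)) x
        + if a = i then ∑ c, pd c (logFactor l) x ^ 2 else 0) := by
  have hd {y} (hy : y ∈ U) := differentiableAt_of_contDiffOn hU hl hy
  rw [covDeriv_id_conformalMetric (hd hx) (hpos x hx).ne',
    pd_congr hU (fun y hy => tension_id_conformalMetric (hd hy) (hpos y hy).ne' a) hx,
    pd_const_mul (differentiableAt_of_contDiffOn hU
      (contDiffOn_pd hU (contDiffOn_logFactor hl hpos) a) hx)]
  simp only [tension_id_conformalMetric (hd hx) (hpos x hx).ne', mul_left_comm _ (2 - (n : ℝ)),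
    ← Finset.mul_sum, sq]
  split_ifs <;> ring

theorem pd_sum_sq (hU : IsOpen U) {f : E n → ℝ} (hf : ContDiffOn ℝ ∞ f U) (hx : x ∈ U)
    (a : Fin n) :
    pd a (fun y => ∑ c, pd c f y ^ 2) x = 2 * ∑ c, pd c f x * pd a (pd c f) x := by
  have hd (c : Fin n) := differentiableAt_of_contDiffOn hU (contDiffOn_pd hU hf c) hx
  simp only [sq]
  rw [pd_sum fun c _ => (hd c).fun_mul (hd c), Finset.mul_sum]
  refine Finset.sum_congr rfl fun c _ => ?_
  rw [pd_mul (hd c) (hd c)]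
  ring

theorem pd_sum_pd_pd (hU : IsOpen U) {f : E n → ℝ} (hf : ContDiffOn ℝ ∞ f U) (hx : x ∈ U)
    (a : Fin n) :
    pd a (fun y => ∑ i, pd i (pd i f) y) x = ∑ i, pd i (pd i (pd a f)) x := by
  rw [pd_sum fun i _ => differentiableAt_of_contDiffOn hU
    (contDiffOn_pd hU (contDiffOn_pd hU hf i) i) hx]
  refine Finset.sum_congr rfl fun i _ => ?_
  rw [pd_comm hU (contDiffOn_pd hU hf i) hx, pd_congr hU (fun y hy => pd_comm hU hf hy a i) hx]

theorem roughLaplacian_tension_id (hU : IsOpen U) (hl : ContDiffOn ℝ ∞ l U)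
    (hpos : ∀ x ∈ U, 0 < l x) (hx : x ∈ U) (a : Fin n) :
    roughLaplacian (euclideanMetric n) (conformalMetric l) id
        (tension (euclideanMetric n) (conformalMetric l) id) a x =
      (2 - n) * (pd a (fun y => ∑ i, pd i (pd i (logFactor l)) y) x
        + 4 * ∑ c, pd c (logFactor l) x * pd a (pd c (logFactor l)) x
        + ((2 - n) * ∑ c, pd c (logFactor l) x ^ 2 - ∑ i, pd i (pd i (logFactor l)) x)
          * pd a (logFactor l) x) := by
  have hσ := contDiffOn_logFactor hl hpos
  have hd {y} (hy : y ∈ U) := differentiableAt_of_contDiffOn hU hl hy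
  have hsq : DifferentiableAt ℝ (fun y => ∑ c, pd c (logFactor l) y ^ 2) x :=
    DifferentiableAt.fun_sum fun c _ =>
      (differentiableAt_of_contDiffOn hU (contDiffOn_pd hU hσ c) hx).pow 2
  have hite (i : Fin n) : DifferentiableAt ℝ
      (fun y => if a = i then ∑ c, pd c (logFactor l) y ^ 2 else 0) x := by
    split_ifs
    exacts [hsq, differentiableAt_const _]
  have ht (i : Fin n) := differentiableAt_of_contDiffOn hU
    (contDiffOn_pd hU (contDiffOn_pd hU hσ a) i) hx
  have hpd (i : Fin n) : pd i (covDeriv (conformalMetric l) id i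
      (tension (euclideanMetric n) (conformalMetric l) id) a) x =
      (2 - n) * (pd i (pd i (pd a (logFactor l))) x
        + if a = i then 2 * ∑ c, pd c (logFactor l) x * pd a (pd c (logFactor l)) x else 0) := by
    rw [pd_congr hU (fun y hy => covDeriv_id_tension hU hl hpos hy i a) hx,
      pd_const_mul ((ht i).fun_add (hite i)), pd_add (ht i) (hite i), pd_ite, pd_sum_sq hU hσ hx]
    congr 2
    split_ifs with h
    exacts [h ▸ rfl, rfl]
  -- The 3 is 2 from differentiating |∇σ|² plus 1 from the trace term of the connection. Summing σᵢ
  -- σₐᵢ over i adds one more, hence the 4 in the statement.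
  have hcov (i : Fin n) : covDeriv (conformalMetric l) id i (covDeriv (conformalMetric l) id i
      (tension (euclideanMetric n) (conformalMetric l) id)) a x =
      (2 - n) * (pd i (pd i (pd a (logFactor l))) x
        + (if a = i then 3 * ∑ c, pd c (logFactor l) x * pd a (pd c (logFactor l)) x
          + 2 * (∑ c, pd c (logFactor l) x ^ 2) * pd a (logFactor l) x else 0)
        + pd i (logFactor l) x * pd a (pd i (logFactor l)) x
        - pd a (logFactor l) x * (pd i (pd i (logFactor l)) x
          + ∑ c, pd c (logFactor l) x ^ 2)) := by
    rw [covDeriv_id_conformalMetric (hd hx) (hpos x hx).ne', hpd]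
    simp only [covDeriv_id_tension hU hl hpos hx, mul_left_comm _ (2 - (n : ℝ)), ← Finset.mul_sum,
      mul_add, Finset.sum_add_distrib, mul_ite, mul_zero, Finset.sum_ite_eq', Finset.mem_univ,
      if_true, pd_comm hU hσ hx i a]
    split_ifs with h
    · subst h; ring
    · ring
  simp only [roughLaplacian, euclideanMetric_inv, Matrix.one_apply, christoffel_euclideanMetric,
    zero_mul, Finset.sum_const_zero, sub_zero, ite_mul, one_mul, Finset.sum_ite_eq,
    Finset.mem_univ, if_true, hcov, pd_sum_pd_pd hU hσ hx, Finset.sum_add_distrib,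
    Finset.sum_sub_distrib, ← Finset.mul_sum, Finset.sum_const, Finset.card_univ,
    Fintype.card_fin, nsmul_eq_mul]
  ring

theorem curvatureTrace_tension_id (hU : IsOpen U) (hl : ContDiffOn ℝ ∞ l U)
    (hpos : ∀ x ∈ U, 0 < l x) (hx : x ∈ U) (a : Fin n) :
    curvatureTrace (euclideanMetric n) (conformalMetric l) id
        (tension (euclideanMetric n) (conformalMetric l) id) a x =
      (2 - n) * ((2 - n) * ∑ c, pd c (logFactor l) x * pd a (pd c (logFactor l)) x
        - (∑ i, pd i (pd i (logFactor l)) x) * pd a (logFactor l) x) := by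
  have hσ := contDiffOn_logFactor hl hpos
  -- The value is the Ricci tensor: tracing with dx² instead of λ² dx² contributes λ², which cancels
  -- the λ⁻² from raising the index a.
  have hsum (b : Fin n) : ∑ i, riemann (conformalMetric l) a i b i x =
      (2 - n) * (pd a (pd b (logFactor l)) x - pd a (logFactor l) x * pd b (logFactor l) x)
      - if a = b then ∑ i, pd i (pd i (logFactor l)) x
        + (n - 2) * ∑ i, pd i (logFactor l) x ^ 2 else 0 := by
    simp only [riemann_conformalMetric hU hl hpos hx, Finset.sum_add_distrib,
      Finset.sum_sub_distrib, ← Finset.mul_sum, Finset.sum_ite_eq,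
      Finset.mem_univ, if_true, Finset.sum_const, Finset.card_univ, Fintype.card_fin, nsmul_eq_mul,
      Finset.sum_ite_irrel, pd_comm hU hσ hx b a]
    rcases eq_or_ne a b with rfl | h
    · simp
      ring_nf
    · simp [h, h.symm]
      ring
  simp only [curvatureTrace, euclideanMetric_inv, Matrix.one_apply, id, pd_coord,
    tension_id_conformalMetric (differentiableAt_of_contDiffOn hU hl hx) (hpos x hx).ne',
    ite_mul, one_mul, zero_mul, mul_ite, mul_one, mul_zero, Finset.sum_ite_eq, Finset.sum_ite_eq',
    Finset.mem_univ, if_true]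
  rw [Finset.sum_comm]
  simp_rw [← Finset.sum_mul, hsum]
  have hb (b : Fin n) (Q : ℝ) :
      ((2 - (n : ℝ)) * (pd a (pd b (logFactor l)) x - pd a (logFactor l) x * pd b (logFactor l) x)
        - if a = b then Q else 0) * ((2 - n) * pd b (logFactor l) x) =
      (2 - n) ^ 2 * (pd b (logFactor l) x * pd a (pd b (logFactor l)) x)
        - (2 - n) ^ 2 * pd a (logFactor l) x * pd b (logFactor l) x ^ 2
        - if a = b then Q * ((2 - n) * pd b (logFactor l) x) else 0 := by
    split_ifs <;> ring
  simp only [hb, Finset.sum_sub_distrib, ← Finset.mul_sum, Finset.sum_ite_eq, Finset.mem_univ,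
    if_true]
  ring

/-- The bitension field of the identity map `(U, dx²) → (U, l² dx²)`. -/
theorem bitension_id_conformalMetric (hU : IsOpen U) (hl : ContDiffOn ℝ ∞ l U)
    (hpos : ∀ x ∈ U, 0 < l x) (hx : x ∈ U) (a : Fin n) :
    bitension (euclideanMetric n) (conformalMetric l) id a x =
      (n - 2) * (pd a (fun y => ∑ i, pd i (pd i (logFactor l)) y) x
        + (6 - n) * ∑ c, pd c (logFactor l) x * pd a (pd c (logFactor l)) x
        + ((2 - n) * ∑ c, pd c (logFactor l) x ^ 2 - 2 * ∑ i, pd i (pd i (logFactor l)) x)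
          * pd a (logFactor l) x) := by
  rw [bitension, roughLaplacian_tension_id hU hl hpos hx, curvatureTrace_tension_id hU hl hpos hx]
  ring

end Conformal

/-! ### Dimension four: bitension, scalar curvature and the Yamabe equation -/

section Four

variable {U : Set (E 4)} {l : E 4 → ℝ} {x : E 4}

theorem scalarCurvature_conformalMetric_four (hU : IsOpen U) (hl : ContDiffOn ℝ ∞ l U)
    (hpos : ∀ x ∈ U, 0 < l x) (hx : x ∈ U) :
    scalarCurvature (conformalMetric l) x = -6 * (∑ i, pd i (pd i l) x) / l x ^ 3 := by
  have := hpos x hx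
  rw [scalarCurvature_conformalMetric hU hl hpos hx, laplacian_eq_logFactor hU hl hpos hx]
  field_simp
  push_cast
  ring

theorem contDiffOn_scalarCurvature_four (hU : IsOpen U) (hl : ContDiffOn ℝ ∞ l U)
    (hpos : ∀ x ∈ U, 0 < l x) : ContDiffOn ℝ ∞ (scalarCurvature (conformalMetric l)) U := by
  refine ContDiffOn.congr (f := fun x => -6 * (∑ i, pd i (pd i l) x) / l x ^ 3) ?_
    fun x hx => scalarCurvature_conformalMetric_four hU hl hpos hx
  refine ContDiffOn.div (contDiffOn_const.mul (ContDiffOn.sum fun i _ =>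
    contDiffOn_pd hU (contDiffOn_pd hU hl i) i)) (hl.pow 3)
    fun x hx => pow_ne_zero 3 (hpos x hx).ne'

/-- In dimension four the bitension field is a multiple of the differential of the scalar
curvature. -/
theorem bitension_eq_pd_scalarCurvature (hU : IsOpen U) (hl : ContDiffOn ℝ ∞ l U)
    (hpos : ∀ x ∈ U, 0 < l x) (hx : x ∈ U) (a : Fin 4) :
    bitension (euclideanMetric 4) (conformalMetric l) id a x =
      -(l x ^ 2 / 3) * pd a (scalarCurvature (conformalMetric l)) x := by
  have hσ := contDiffOn_logFactor hl hpos
  have hlx := differentiableAt_of_contDiffOn hU hl hx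
  have hsq : DifferentiableAt ℝ (fun y => ∑ c, pd c (logFactor l) y ^ 2) x :=
    DifferentiableAt.fun_sum fun c _ =>
      (differentiableAt_of_contDiffOn hU (contDiffOn_pd hU hσ c) hx).pow 2
  have hlap : DifferentiableAt ℝ (fun y => ∑ i, pd i (pd i (logFactor l)) y) x :=
    DifferentiableAt.fun_sum fun i _ =>
      differentiableAt_of_contDiffOn hU (contDiffOn_pd hU (contDiffOn_pd hU hσ i) i) hx
  have hR := differentiableAt_of_contDiffOn hU (contDiffOn_scalarCurvature_four hU hl hpos) hx
  -- Clearing the denominator λ² makes the right side a polynomial in derivatives of σ, to be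
  -- differentiated by the product rule.
  have hE : EqOn (fun y => l y * l y * scalarCurvature (conformalMetric l) y)
      (fun y => -6 * (∑ i, pd i (pd i (logFactor l)) y + ∑ c, pd c (logFactor l) y ^ 2)) U := by
    intro y hy
    have := hpos y hy
    simp only [scalarCurvature_conformalMetric hU hl hpos hy]
    field_simp
    push_cast
    ring
  have hpd := pd_congr hU hE hx a
  rw [pd_mul (hlx.fun_mul hlx) hR, pd_mul hlx hlx, pd_const_mul (hlap.fun_add hsq),
    pd_add hlap hsq, pd_sum_sq hU hσ hx] at hpd
  have hE' := hE hx
  have hlog : pd a l x = l x * pd a (logFactor l) x := by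
    have : pd a (logFactor l) x = pd a l x / l x := pd_log hlx (hpos x hx).ne' a
    rw [this]
    field_simp [(hpos x hx).ne']
  rw [hlog] at hpd
  simp only at hE'
  rw [bitension_id_conformalMetric hU hl hpos hx]
  push_cast
  -- Differentiating λ² produces the extra term 2λ² S σₐ; the undifferentiated identity `hE'`
  -- removes it.
  linear_combination (1 / 3) * hpd - (2 / 3) * pd a (logFactor l) x * hE'

theorem isBiharmonicMetric_iff (hU : IsOpen U) (hUc : IsPreconnected U) (hl : ContDiffOn ℝ ∞ l U)
    (hpos : ∀ x ∈ U, 0 < l x) :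
    IsBiharmonicMetric U (euclideanMetric 4) (conformalMetric l) ↔
      ∃ R : ℝ, ∀ x ∈ U, scalarCurvature (conformalMetric l) x = R := by
  constructor
  · rintro ⟨-, -, h⟩
    refine exists_eq_const_of_pd_eq_zero hU hUc (contDiffOn_scalarCurvature_four hU hl hpos)
      fun x hx a => ?_
    have := h x hx a
    rw [bitension_eq_pd_scalarCurvature hU hl hpos hx] at this
    exact (mul_eq_zero.1 this).resolve_left (by have := hpos x hx; simp; positivity)
  · rintro ⟨R, hR⟩
    refine ⟨mapsTo_id U, contDiffOn_id, fun x hx a => ?_⟩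
    rw [bitension_eq_pd_scalarCurvature hU hl hpos hx, pd_congr hU hR hx a, pd_const, mul_zero]

theorem solvesYamabe_iff (R : ℝ) :
    SolvesYamabe U (euclideanMetric 4) R l ↔
      ∀ x ∈ U, ∑ i, pd i (pd i l) x = -(R / 6) * l x ^ 3 := by
  refine forall₂_congr fun x _ => ?_
  rw [laplaceBeltrami_euclideanMetric, scalarCurvature_euclideanMetric,
    -- The Yamabe exponent is a real power; for n = 4 it becomes the natural power 3.
    show (((4 : ℕ) : ℝ) + 2) / (((4 : ℕ) : ℝ) - 2) = ((3 : ℕ) : ℝ) by norm_num,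
    Real.rpow_natCast]
  push_cast
  constructor <;> intro h <;> linarith

theorem scalarCurvature_eq_iff (hU : IsOpen U) (hl : ContDiffOn ℝ ∞ l U)
    (hpos : ∀ x ∈ U, 0 < l x) (hx : x ∈ U) (R : ℝ) :
    scalarCurvature (conformalMetric l) x = R ↔
      ∑ i, pd i (pd i l) x = -(R / 6) * l x ^ 3 := by
  rw [scalarCurvature_conformalMetric_four hU hl hpos hx,
    div_eq_iff (pow_ne_zero 3 (hpos x hx).ne')]
  constructor <;> intro h <;> linarith

end Four

end BiharmonicMetric

end

open BiharmonicMetric in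
theorem mainTheorem5 (U : Set (EuclideanSpace ℝ (Fin 4))) (hU : IsOpen U)
    (hUc : IsPreconnected U) (l : EuclideanSpace ℝ (Fin 4) → ℝ)
    (hl : ContDiffOn ℝ ∞ l U) (hpos : ∀ x ∈ U, 0 < l x) :
    (BiharmonicMetric.IsBiharmonicMetric U (BiharmonicMetric.euclideanMetric 4)
        (BiharmonicMetric.conformalMetric l) ↔
      ∃ R : ℝ, BiharmonicMetric.SolvesYamabe U (BiharmonicMetric.euclideanMetric 4) R l) ∧
    (∀ R : ℝ, BiharmonicMetric.SolvesYamabe U (BiharmonicMetric.euclideanMetric 4) R l ↔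
      (∀ x ∈ U, BiharmonicMetric.scalarCurvature (BiharmonicMetric.conformalMetric l) x = R) ∧
      (∀ x ∈ U, Laplacian.laplacian l x = -(R / 6) * (l x) ^ 3)) := by
  have hYam (R : ℝ) : SolvesYamabe U (euclideanMetric 4) R l ↔
      ∀ x ∈ U, scalarCurvature (conformalMetric l) x = R :=
    (solvesYamabe_iff R).trans
      (forall₂_congr fun x hx => (scalarCurvature_eq_iff hU hl hpos hx R).symm)
  refine ⟨?_, fun R => ?_⟩
  · simp only [hYam]
    exact isBiharmonicMetric_iff hU hUc hl hpos
  -- The curvature condition alone already implies the Yamabe equation, so the converse ignores the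
  -- Laplacian.
  · refine ⟨fun h => ⟨(hYam R).1 h, fun x hx => ?_⟩, fun h => (hYam R).2 h.1⟩
    rw [laplacian_eq_sum_pd hU hl hx]
    exact (solvesYamabe_iff R).1 h x hx
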